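/- Consider words over the binary alphabet $\{0,1\}$. A word $w$ is \emph{bordered} if some nonempty word $b\neq w$ is both a prefix and a suffix of $w$, and \emph{unbordered} otherwise. Words $w,w'$ are \emph{conjugates} if $w=xy$ and $w'=yx$ for some words $x,y$. A binary word $w$ is \emph{fully bordered} if $|w|>1$ and $w$ has exactly two unbordered conjugates. If $w$ is fully bordered and its two unbordered conjugates are $uv$ and $vu$, then $(u,v)$ is called a \emph{fully bordered pair}. The \emph{palindromic length} of a word is the least number of nonempty palindromes whose concatenation is that word. \textbf{Theorem.} If $(u,v)$ is a fully bordered pair, then both $u$ and $v$ are palindromes. Consequently, every fully bordered word $w$ is a product $w=pq$ of two (possibly empty) palindromes $p,q$, so its palindromic length is at most two. The palindromic length of $w$ is exactly two whenever $w$ is not itself a palindrome; in particular, this holds when $w$ is unbordered. -/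

import Mathlib

/-- `b` is a border of `w`: a nonempty word different from `w` that is both a prefix and a
suffix of `w`. -/
def IsBorder {α : Type*} (b w : List α) : Prop :=
  b ≠ [] ∧ b ≠ w ∧ b <+: w ∧ b <:+ w

/-- A word is unbordered if it has no border. -/
def Unbordered {α : Type*} (w : List α) : Prop :=
  ¬ ∃ b : List α, IsBorder b w

/-- The set of the unbordered conjugates of `w`; two words are conjugate if one is a cyclic
rotation of the other. -/
def unborderedConjugates {α : Type*} (w : List α) : Set (List α) :=
  {z | List.IsRotated w z ∧ Unbordered z}

/-- A binary word is fully bordered if its length is greater than one and it has exactly two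
unbordered conjugates. Binary words are lists over `Bool`, with letters `false` and `true` in the
roles of `0` and `1`. -/
def FullyBordered (w : List Bool) : Prop :=
  1 < w.length ∧ (unborderedConjugates w).ncard = 2

/-- `(u, v)` is a fully bordered pair if `uv` and `vu` are the (two) unbordered conjugates of a
fully bordered word. -/
def FullyBorderedPair (u v : List Bool) : Prop :=
  ∃ w : List Bool, FullyBordered w ∧ unborderedConjugates w = {u ++ v, v ++ u}

/-- The palindromic length of `w`: the least number of nonempty palindromes whose concatenation
is `w`. -/
noncomputable def palindromicLength {α : Type*} (w : List α) : ℕ :=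
  sInf {n : ℕ | ∃ l : List (List α),
    l.length = n ∧ (∀ p ∈ l, p ≠ [] ∧ p.Palindrome) ∧ l.flatten = w}

/-- The minimum in the definition of the palindromic length is attained, since a word is the
product of its letters. -/
theorem exists_palindromic_factorization {α : Type*} (w : List α) :
    ∃ l : List (List α), l.length = palindromicLength w ∧
      (∀ p ∈ l, p ≠ [] ∧ p.Palindrome) ∧ l.flatten = w := by
  have h : {n : ℕ | ∃ l : List (List α),
      l.length = n ∧ (∀ p ∈ l, p ≠ [] ∧ p.Palindrome) ∧ l.flatten = w}.Nonempty := by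
    refine ⟨_, w.map (fun a => [a]), rfl, ?_, ?_⟩
    · intro p hp
      obtain ⟨a, -, rfl⟩ := List.mem_map.1 hp
      exact ⟨by simp, List.Palindrome.singleton a⟩
    · induction w with
      | nil => rfl
      | cons a t ih => simp [ih]
  exact Nat.sInf_mem h

/-! Repeat a fully bordered word periodically over ℤ, with period `n`. Its unbordered conjugates
start exactly at the critical points, so up to shifts there are two, `P` and `Q`. The claim becomes
that the periodic word is invariant under `x ↦ P + Q - 1 - x`; both palindromes are read off from
this reflection.

A lexicographically minimal position is critical. Applied to both orders of the alphabet, this shows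
that `P` and `Q` carry different letters, so each is the only critical point, up to shifts, with its
letter, and each is minimal for one order. The crux is `returnsExtendFirst_of_unique`: if some
return word to a prefix at `P` did not extend the first one, a minimal position of the word of
return words would be another critical point with the same letter.

By reversal the same holds for reading leftwards. The return words then let palindromes around `P`
and `Q` grow (`PalindromicArms.extend_or_extend`), starting from single letters, until one of them
covers a whole period. -/

/-! ### Critical points and lexicographic minimality -/

/-- Position `i` of a bi-infinite word is critical with respect to `n` if no square of period less
than `n` is centered at `i`. -/
def CriticalPoint {α : Type*} (w : ℤ → α) (n : ℕ) (i : ℤ) : Prop :=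
  ∀ p : ℕ, 0 < p → p < n → ∃ t : ℕ, t < p ∧ w (i - p + t) ≠ w (i + t)

/-- The right-infinite word starting at `P` is lexicographically minimal among all shifts. -/
def LexMinAt {α : Type*} [LE α] (w : ℤ → α) (P : ℤ) : Prop :=
  ∀ (i : ℤ) (t : ℕ), (∀ s : ℕ, s < t → w (i + s) = w (P + s)) → w (P + t) ≤ w (i + t)

theorem exists_lexMinAt {α : Type*} [LinearOrder α] {w : ℤ → α} {n : ℕ} (hn : 0 < n)
    (hw : Function.Periodic w n) : ∃ P, LexMinAt w P := by
  obtain ⟨k, -, hk⟩ := Finset.exists_min_image (Finset.range n)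
    (fun k : ℕ => (toLex (fun t : ℕ => w (k + t)) : Lex (ℕ → α))) ⟨0, by simpa using hn⟩
  refine ⟨k, fun i t h => ?_⟩
  by_contra! hlt
  have hn' : (0 : ℤ) < n := by exact_mod_cast hn
  have h0 := Int.emod_nonneg i hn'.ne'
  have h1 := Int.emod_lt_of_pos i hn'
  have hmod : ∀ x : ℤ, w ((i % n).toNat + x) = w (i + x) := by
    intro x
    rw [Int.toNat_of_nonneg h0]
    have := hw.sub_zsmul_eq (x := i + x) (i / n)
    rw [← this]
    congr 1
    have := Int.emod_add_mul_ediv i n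
    simp only [smul_eq_mul]
    linarith
  have := hk (i % n).toNat (by simp; omega)
  refine absurd this (not_le.2 ?_)
  refine ⟨t, fun s hs => ?_, ?_⟩
  · exact (hmod s).trans (h s hs)
  · exact (hmod t).trans_lt hlt

theorem periodic_of_forall_add_nat {α : Type*} {w : ℤ → α} {n : ℕ} (hn : 0 < n)
    (hw : Function.Periodic w n) {i p : ℤ} (h : ∀ t : ℕ, w (i - p + t) = w (i + t)) :
    Function.Periodic w p := by
  intro x
  have hn' : (1 : ℤ) ≤ n := by exact_mod_cast hn
  obtain ⟨t, ht⟩ : ∃ t : ℕ, (t : ℤ) = x + |x - i + p| * n - (i - p) := by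
    refine ⟨(x + |x - i + p| * n - (i - p)).toNat, Int.toNat_of_nonneg ?_⟩
    nlinarith [neg_abs_le (x - i + p), abs_nonneg (x - i + p)]
  have h1 := h t
  rw [ht] at h1
  have e1 := hw.zsmul |x - i + p| x
  have e2 := hw.zsmul |x - i + p| (x + p)
  simp only [smul_eq_mul] at e1 e2
  rw [← e1, ← e2]
  convert h1.symm using 2 <;> ring

/-- Minimality forbids the word at `P - p` to drop below the word at `P`. Once the first `p` letters
agree, it cannot rise above it either, since the comparison becomes that of `P` with `P + p`. -/
theorem LexMinAt.periodic {α : Type*} [LinearOrder α] {w : ℤ → α} {n p : ℕ} {P : ℤ} (hn : 0 < n)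
    (hw : Function.Periodic w n) (hP : LexMinAt w P)
    (h : ∀ t : ℕ, t < p → (∀ s : ℕ, s < t → w (P - p + s) = w (P + s)) →
      w (P - p + t) ≤ w (P + t)) : Function.Periodic w p := by
  refine periodic_of_forall_add_nat hn hw (i := P) fun t => ?_
  induction t using Nat.strong_induction_on with
  | _ t ih =>
    refine le_antisymm ?_ (hP _ t ih)
    rcases lt_or_ge t p with htp | htp
    · exact h t htp ih
    · obtain ⟨r, rfl⟩ := Nat.exists_eq_add_of_le htp
      have := hP (P + p) r fun s hs => by
        have := ih (p + s) (by omega)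
        push_cast at this
        rw [add_assoc, ← this]
        congr 1; ring
      convert this using 2 <;> push_cast <;> ring

theorem CriticalPoint.not_periodic {α : Type*} {w : ℤ → α} {n p : ℕ} {i : ℤ}
    (hi : CriticalPoint w n i) (hp : 0 < p) (hpn : p < n) : ¬ Function.Periodic w p := by
  intro h
  obtain ⟨t, -, ht⟩ := hi p hp hpn
  apply ht
  rw [← h]
  congr 1; ring

theorem LexMinAt.criticalPoint {α : Type*} [LinearOrder α] {w : ℤ → α} {n : ℕ} {P i : ℤ}
    (hn : 0 < n) (hw : Function.Periodic w n) (hi : CriticalPoint w n i) (hP : LexMinAt w P) :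
    CriticalPoint w n P := by
  intro p hp hpn
  by_contra! h
  exact hi.not_periodic hp hpn (hP.periodic hn hw fun t ht _ => (h t ht).le)

/-- If the prefix of length `m` of the minimal word occurs at `i`, and it agrees with the word at
`i - q` on the first `q` letters, then it occurs at `i - q`. -/
theorem LexMinAt.occurrence_sub {α : Type*} [LinearOrder α] {w : ℤ → α} {P i : ℤ} {m q : ℕ}
    (hP : LexMinAt w P) (hi : ∀ t : ℕ, t < m → w (i + t) = w (P + t))
    (hq : ∀ t : ℕ, t < q → t < m → w (i - q + t) = w (P + t)) :
    ∀ t : ℕ, t < m → w (i - q + t) = w (P + t) := by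
  intro t
  induction t using Nat.strong_induction_on with
  | _ t ih =>
    intro htm
    rcases lt_or_ge t q with htq | htq
    · exact hq t htq htm
    obtain ⟨r, rfl⟩ := Nat.exists_eq_add_of_le htq
    have e1 : w (i - q + (q + r : ℕ)) = w (P + r) := by
      rw [← hi r (by omega)]; congr 1; push_cast; ring
    refine le_antisymm ?_ (hP _ _ fun s hs => ih s hs (by omega))
    have := hP (P + q) r fun s hs => by
      have h1 := ih (q + s) (by omega) (by omega)
      rw [← hi s (by omega), add_assoc]
      push_cast at h1
      rw [← h1]
      congr 1; ring
    rw [e1]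
    convert this using 2; push_cast; ring

/-! ### Return words -/

/-- The distance from `i` to the next position satisfying `O`. -/
noncomputable def nextDist (O : ℤ → Prop) (i : ℤ) : ℕ := sInf {e : ℕ | 0 < e ∧ O (i + e)}

theorem nextDist_spec {O : ℤ → Prop} {i : ℤ} {e : ℕ} (he : 0 < e) (h : O (i + e)) :
    0 < nextDist O i ∧ O (i + nextDist O i) ∧ nextDist O i ≤ e :=
  have h' : e ∈ {e : ℕ | 0 < e ∧ O (i + e)} := ⟨he, h⟩
  ⟨(Nat.sInf_mem ⟨e, h'⟩).1, (Nat.sInf_mem ⟨e, h'⟩).2, Nat.sInf_le h'⟩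

theorem exists_last_before {O : ℤ → Prop} {i : ℤ} (hi : O i) (t : ℕ) (ht : 0 < t) :
    ∃ s : ℕ, s < t ∧ O (i + s) ∧ ∀ r : ℕ, s < r → r < t → ¬ O (i + r) := by
  classical
  have h0 : O (i + (0 : ℕ)) := by simpa using hi
  have hs : Nat.findGreatest (fun s => O (i + s)) (t - 1) ≤ t - 1 := Nat.findGreatest_le _
  refine ⟨Nat.findGreatest (fun s => O (i + s)) (t - 1), by omega,
    Nat.findGreatest_spec (P := fun s : ℕ => O (i + s)) (Nat.zero_le _) h0, fun r h1 h2 => ?_⟩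
  exact Nat.findGreatest_is_greatest h1 (by omega)

theorem nextDist_eq_of_last {O : ℤ → Prop} {i : ℤ} {s t : ℕ} (hst : s < t) (ht : O (i + t))
    (h : ∀ r : ℕ, s < r → r < t → ¬ O (i + r)) : nextDist O (i + s) = t - s := by
  have ht' : O (i + s + (t - s : ℕ)) := by
    convert ht using 1; push_cast [hst.le]; ring
  obtain ⟨h1, h2, h3⟩ := nextDist_spec (by omega) ht'
  by_contra hne
  refine h (s + nextDist O (i + s)) (by omega) (by omega) ?_
  convert h2 using 1; push_cast; ring

/-- For every nonempty prefix of the word at `P`, the first return word at `P` is a prefix of all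
return words. -/
def ReturnsExtendFirst {α : Type*} (w : ℤ → α) (P : ℤ) : Prop :=
  ∀ m : ℕ, 0 < m → ∃ d : ℕ, 0 < d ∧ (∀ t : ℕ, t < m → w (P + d + t) = w (P + t)) ∧
    ∀ i : ℤ, (∀ t : ℕ, t < m → w (i + t) = w (P + t)) →
      (∀ t : ℕ, t < d → w (i + t) = w (P + t)) ∧
      ∀ e : ℕ, 0 < e → e < d → ¬ ∀ t : ℕ, t < m → w (i + e + t) = w (P + t)

/-- Read the word as a sequence of return words, ordered so that those not extending the first one
come lowest. If one exists, a minimal position for this order starts with one, yet is critical in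
`w`, hence a shift of `P`: a contradiction. -/
theorem returnsExtendFirst_of_unique {α : Type*} [LinearOrder α] [Encodable α] {w : ℤ → α} {n : ℕ}
    {P : ℤ} (hn : 0 < n) (hw : Function.Periodic w n) (hc : CriticalPoint w n P)
    (hP : LexMinAt w P)
    (huniq : ∀ i, CriticalPoint w n i → w i = w P → ∀ x : ℤ, w (i + x) = w (P + x)) :
    ReturnsExtendFirst w P := by
  classical
  intro m hm
  set O : ℤ → Prop := fun i => ∀ t : ℕ, t < m → w (i + t) = w (P + t) with hO
  have hOP : O P := fun t _ => rfl
  have hOn : ∀ i, O (i + n) ↔ O i := fun i => by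
    have : ∀ t : ℕ, w (i + n + t) = w (i + t) := fun t => by rw [← hw (i + t)]; congr 1; ring
    simp only [hO, this]
  have hnext : ∀ i, O i → 0 < nextDist O i ∧ O (i + nextDist O i) ∧ nextDist O i ≤ n :=
    fun i hi => nextDist_spec hn ((hOn i).2 hi)
  set d := nextDist O P with hd
  obtain ⟨hd0, hOd, -⟩ := hnext P hOP
  set good : ℤ → Prop := fun i => d ≤ nextDist O i ∧ ∀ t : ℕ, t < d → w (i + t) = w (P + t)
    with hgood
  suffices hall : ∀ i, O i → good i by
    refine ⟨d, hd0, hOd, fun i hi => ⟨(hall i hi).2, fun e he hed hOe => ?_⟩⟩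
    have := (nextDist_spec (O := O) he hOe).2.2
    have := (hall i hi).1
    omega
  by_contra! hbad
  obtain ⟨b, hOb, hb⟩ := hbad
  -- return words are ordered by: extending the first one or not, then length, then content
  let word : ℤ → List α := fun i => (List.range (nextDist O i)).map fun t : ℕ => w (i + t)
  let K : ℤ → ℕ ×ₗ (ℕ ×ₗ ℕ) := fun i =>
    if O i then toLex (if good i then 1 else 0, toLex (nextDist O i, Encodable.encode (word i)))
    else toLex (2, toLex (0, 0))
  have hshift : ∀ i j : ℤ, (∀ x : ℤ, w (i + x) = w (j + x)) → K i = K j := by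
    intro i j h
    have hOO : ∀ x : ℤ, O (i + x) ↔ O (j + x) := fun x => by simp only [hO, add_assoc, h]
    have hO0 : O i ↔ O j := by simpa using hOO 0
    have hnd : nextDist O i = nextDist O j := by simp only [nextDist, hOO]
    simp only [K, word, hgood, hO0, hnd, h]
  have hKper : Function.Periodic K n := fun i => hshift _ _ fun x => by
    rw [← hw (i + x)]; congr 1; ring
  have hKeq : ∀ i j, O i → K i = K j → O j ∧ nextDist O i = nextDist O j ∧ word i = word j := by
    intro i j hi h
    have hj : O j := by
      by_contra hj
      simp only [K, hi, hj, if_true, if_false] at h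
      have := congrArg (fun k => (ofLex k).1) h
      simp only [ofLex_toLex] at this
      split_ifs at this
      all_goals omega
    simp only [K, hi, hj, if_true] at h
    have h2 := congrArg (fun k => (ofLex (ofLex k).2)) h
    simp only [ofLex_toLex, Prod.mk.injEq] at h2
    exact ⟨hj, h2.1, Encodable.encode_injective h2.2⟩
  have hword : ∀ i j, nextDist O i = nextDist O j → word i = word j → ∀ t : ℕ,
      t < nextDist O i → w (i + t) = w (j + t) := by
    intro i j h1 h2 t ht
    simp only [word, ← h1] at h2
    exact List.map_inj_left.1 h2 t (by simpa using ht)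
  obtain ⟨i₀, hi₀⟩ := exists_lexMinAt hn hKper
  have hle : ∀ i, K i₀ ≤ K i := fun i => by
    have := hi₀ i 0 (by simp)
    simpa using this
  have hbK : (ofLex (K i₀)).1 = 0 := by
    have h := Prod.Lex.monotone_fst _ _ (hle b)
    simp only [K, hOb, hb, if_true, if_false] at h
    simpa using h
  have hOi : O i₀ := by
    by_contra h
    simp [K, h] at hbK
  have hnotgood : ¬ good i₀ := by
    intro h
    simp [K, hOi, h] at hbK
  -- A square of period `p` centered at `i₀` makes `i₀ - p` an occurrence; comparing the keys from
  -- there with those from `i₀` gives `K`, and hence `w`, the period `p`.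
  have hcrit : CriticalPoint w n i₀ := by
    intro p hp hpn
    by_contra! hsq
    have hOj : O (i₀ - p) := hP.occurrence_sub hOi fun t ht htm => by rw [hsq t ht, hOi t htm]
    have hKp : Function.Periodic K p := by
      refine hi₀.periodic hn hKper fun t htp hag => ?_
      -- the first difference can only be at occurrences
      have hOt : O (i₀ - p + t) ↔ O (i₀ + t) := by
        rcases Nat.eq_zero_or_pos t with rfl | ht
        · simpa using iff_of_true hOj hOi
        · constructor
          · intro h
            obtain ⟨s, hst, hs, hlast⟩ := exists_last_before hOj t ht
            obtain ⟨h1, h2, -⟩ := hKeq _ _ hs (hag s hst)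
            rw [nextDist_eq_of_last hst h hlast] at h2
            have := (hnext _ h1).2.1
            rw [← h2] at this
            convert this using 1; push_cast [hst.le]; ring
          · intro h
            obtain ⟨s, hst, hs, hlast⟩ := exists_last_before hOi t ht
            obtain ⟨h1, h2, -⟩ := hKeq _ _ hs (hag s hst).symm
            rw [nextDist_eq_of_last hst h hlast] at h2
            have := (hnext _ h1).2.1
            rw [← h2] at this
            convert this using 1; push_cast [hst.le]; ring
      by_cases hOr : O (i₀ - p + t)
      swap
      · have hOs := hOt.not.1 hOr
        simp [K, hOr, hOs]
      have hOs := hOt.1 hOr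
      obtain ⟨r0, hr, -⟩ := hnext _ hOr
      obtain ⟨s0, hs, -⟩ := hnext _ hOs
      have hrp : nextDist O (i₀ - p + t) ≤ p - t := by
        refine (nextDist_spec (e := p - t) (by omega) ?_).2.2
        convert hOi using 1; push_cast [htp.le]; ring
      have hagree : ∀ x : ℕ, t + x < p → w (i₀ - p + t + x) = w (i₀ + t + x) := fun x hx => by
        have := hsq (t + x) hx
        push_cast at this
        simpa [add_assoc] using this
      -- The left return word ends by `i₀`, inside the square. A shorter return on the right would
      -- be copied to the left up to `i₀`, and `LexMinAt.occurrence_sub` completes the copied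
      -- occurrence beyond `i₀`.
      have hrs : nextDist O (i₀ - p + t) ≤ nextDist O (i₀ + t) := by
        by_contra! hlt
        set s := nextDist O (i₀ + t)
        have : O (i₀ - (p - t - s : ℕ)) := by
          refine hP.occurrence_sub hOi fun x hx hxm => ?_
          have h1 := hagree (s + x) (by omega)
          rw [← hs x hxm]
          convert h1 using 2
          · push_cast [show t ≤ p by omega, show s ≤ p - t by omega]; ring
          · push_cast; ring
        have := (nextDist_spec (O := O) (i := i₀ - p + t) (e := s) (by omega) (by
          convert this using 1
          push_cast [show t ≤ p by omega, show s ≤ p - t by omega]; ring)).2.2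
        omega
      rcases hrs.eq_or_lt with heq | hlt
      · refine le_of_eq ?_
        have hw' : word (i₀ - p + t) = word (i₀ + t) := by
          simp only [word, ← heq]
          refine List.map_inj_left.2 fun x hx => hagree x ?_
          rw [List.mem_range] at hx
          omega
        have hg : good (i₀ - p + t) ↔ good (i₀ + t) := by
          simp only [hgood, ← heq]
          refine and_congr_right fun hdx => forall_congr' fun x => forall_congr' fun hx => ?_
          rw [hagree x (by omega)]
        simp only [K, hOr, hOs, if_true, hw', hg, heq]
      · have hg : good (i₀ - p + t) → good (i₀ + t) := fun h => ⟨h.1.trans hrs, fun x hx => by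
          have := h.1
          rw [← hagree x (by omega)]; exact h.2 x hx⟩
        simp only [K, hOr, hOs, if_true]
        rw [Prod.Lex.toLex_le_toLex]
        have hlt' : toLex (nextDist O (i₀ - p + t), Encodable.encode (word (i₀ - p + t))) ≤
            toLex (nextDist O (i₀ + t), Encodable.encode (word (i₀ + t))) :=
          Prod.Lex.toLex_le_toLex.2 (Or.inl hlt)
        by_cases h1 : good (i₀ - p + t)
        · simp only [h1, hg h1, if_true]
          exact Or.inr ⟨trivial, hlt'⟩
        · by_cases h2 : good (i₀ + t)
          · simp [h1, h2]
          · simp only [h1, h2, if_false]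
            exact Or.inr ⟨trivial, hlt'⟩
    -- Every letter lies in the return word of the last occurrence before it, and the key records
    -- that word.
    refine hc.not_periodic hp hpn (periodic_of_forall_add_nat hn hw (i := i₀ + p) fun t => ?_)
    obtain ⟨s, hst, hs, hlast⟩ := exists_last_before hOi (t + 1) (by omega)
    obtain ⟨h1, h2, h3⟩ := hKeq _ _ hs (hKp (i₀ + s)).symm
    obtain ⟨g0, g1, -⟩ := hnext _ hs
    have hlt : t - s < nextDist O (i₀ + s) := by
      by_contra! hge
      refine hlast (s + nextDist O (i₀ + s)) (by omega) (by omega) ?_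
      convert g1 using 1; push_cast; ring
    have := hword _ _ h2 h3 (t - s) hlt
    convert this using 2 <;> (push_cast [show s ≤ t by omega]; ring)
  have hKP := hshift _ _ (huniq i₀ hcrit (by simpa using hOi 0 hm))
  have hgP : good P := ⟨le_rfl, fun _ _ => rfl⟩
  rw [hKP] at hbK
  simp [K, hOP, hgP] at hbK

theorem ReturnsExtendFirst.exists_return {α : Type*} {w : ℤ → α} {P : ℤ}
    (hF : ReturnsExtendFirst w P) {m : ℕ} (hm : 0 < m) :
    ∃ d : ℤ, 0 < d ∧ (∀ x y : ℤ, P ≤ y → y < P + m → x = y + d → w x = w y) ∧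
      ∀ i : ℤ, (∀ x y : ℤ, P ≤ y → y < P + m → x - i = y - P → w x = w y) →
        (∀ x y : ℤ, P ≤ y → y < P + d → x - i = y - P → w x = w y) ∧
        ∀ j : ℤ, (∀ x y : ℤ, P ≤ y → y < P + m → x - j = y - P → w x = w y) →
          i < j → i + d ≤ j := by
  obtain ⟨d, hd, hPd, h⟩ := hF m hm
  have key : ∀ (i : ℤ) (k : ℕ), (∀ x y : ℤ, P ≤ y → y < P + k → x - i = y - P → w x = w y) ↔
      ∀ t : ℕ, t < k → w (i + t) = w (P + t) := by
    refine fun i k => ⟨fun h t ht => h _ _ (by omega) (by omega) (by omega),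
      fun h x y h1 h2 h3 => ?_⟩
    obtain ⟨t, rfl⟩ := Int.le.dest h1
    obtain rfl : x = i + t := by omega
    exact h t (by omega)
  refine ⟨d, by exact_mod_cast hd, ?_, fun i hi => ?_⟩
  · intro x y h1 h2 h3
    exact (key (P + d) m).2 hPd x y h1 h2 (by omega)
  · obtain ⟨h1, h2⟩ := h i ((key i m).1 hi)
    refine ⟨(key i d).2 h1, fun j hj hij => ?_⟩
    by_contra! hlt
    obtain ⟨e, rfl⟩ := Int.le.dest hij.le
    exact h2 e (by omega) (by omega) ((key _ m).1 hj)

/-! ### Growing palindromic arms -/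

/-- The word `z` of length `a` read forward from `P` is a palindrome and coincides with the word
read backward from `Q`. -/
def PalindromicArms {α : Type*} (w : ℤ → α) (P Q a : ℤ) : Prop :=
  (∀ x y : ℤ, P ≤ x → x < P + a → x + y = P + Q - 1 → w x = w y) ∧
    ∀ x y : ℤ, P ≤ x → x < P + a → x + y = 2 * P + a - 1 → w x = w y

/-- As `z` is a palindrome, its occurrences are the same read from either side, so the first returns
from `P` rightwards and from `Q` leftwards both have the least return length `d`. The arm then
extends by `d`, provided any gap between the two copies of `z` is short enough to be reflected by
`hy`. -/
theorem PalindromicArms.exists_extension {α : Type*} {w : ℤ → α} {P Q : ℤ} {a b : ℕ}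
    (ha : 0 < a) (hF : ReturnsExtendFirst w P)
    (hB : ReturnsExtendFirst (fun x => w (-1 - x)) (-Q)) (hz : PalindromicArms w P Q a)
    (hy : ∀ x y : ℤ, Q ≤ x → x < Q + b → x + y = P + Q - 1 → w x = w y) :
    ∃ d : ℤ, 0 < d ∧ (d ≤ a + b → PalindromicArms w P Q (a + d)) ∧
      ∀ i : ℤ, (∀ x y : ℤ, P ≤ y → y < P + a → x - i = y - P → w x = w y) →
        (∀ x y : ℤ, P ≤ y → y < P + d → x - i = y - P → w x = w y) ∧
        ∀ j : ℤ, (∀ x y : ℤ, P ≤ y → y < P + a → x - j = y - P → w x = w y) →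
          i < j → i + d ≤ j := by
  obtain ⟨h1, h2⟩ := hz
  obtain ⟨d, hd, hPd, h⟩ := hF.exists_return ha
  obtain ⟨d', hd', hPd', h'⟩ := hB.exists_return ha
  -- occurrences seen from the right are occurrences seen from the left
  have occ : ∀ i : ℤ, (∀ x y : ℤ, P ≤ y → y < P + a → x - i = y - P → w x = w y) ↔
      ∀ x y : ℤ, -Q ≤ y → y < -Q + a → x - (-i - a) = y - (-Q) → w (-1 - x) = w (-1 - y) := by
    intro i
    constructor
    · intro hi x y e1 e2 e3
      rw [hi (-1 - x) (P + a - 1 - (y + Q)) (by omega) (by omega) (by omega),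
        ← h2 (P + (y + Q)) _ (by omega) (by omega) (by omega),
        h1 (P + (y + Q)) (-1 - y) (by omega) (by omega) (by omega)]
    · intro hi x y e1 e2 e3
      have := hi (-1 - x) (-Q + (a - 1 - (y - P))) (by omega) (by omega) (by omega)
      rw [show -1 - (-1 - x) = x by ring] at this
      rw [this, ← h1 (P + (a - 1 - (y - P))) _ (by omega) (by omega) (by omega),
        h2 _ y (by omega) (by omega) (by omega)]
  have occP : ∀ x y : ℤ, P ≤ y → y < P + a → x - P = y - P → w x = w y := by
    intro x y _ _ e
    rw [show x = y by omega]
  have occPd : ∀ x y : ℤ, P ≤ y → y < P + a → x - (P + d) = y - P → w x = w y :=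
    fun x y e1 e2 e3 => hPd x y e1 e2 (by omega)
  have occQ : ∀ x y : ℤ, P ≤ y → y < P + a → x - (Q - a) = y - P → w x = w y := by
    refine (occ _).2 fun x y _ _ e => ?_
    rw [show x = y by omega]
  have occQd : ∀ x y : ℤ, P ≤ y → y < P + a → x - (Q - a - d') = y - P → w x = w y :=
    (occ _).2 fun x y e1 e2 e3 => hPd' x y e1 e2 (by omega)
  have hdd : d = d' := by
    apply le_antisymm
    · have := (h _ occQd).2 _ occQ (by omega)
      omega
    · have := (h' _ ((occ _).1 occPd)).2 _ ((occ _).1 occP) (by omega)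
      omega
  subst hdd
  have E1 : ∀ x y : ℤ, P ≤ y → y < P + (a + d) → x - (Q - a - d) = y - P → w x = w y := by
    intro x y e1 e2 e3
    rcases lt_or_ge y (P + d) with hlt | hge
    · exact (h _ occQd).1 x y e1 hlt e3
    · rw [occQ x (y - d) (by omega) (by omega) (by omega),
        occPd y (y - d) (by omega) (by omega) (by omega)]
  refine ⟨d, hd, fun hle => ?_, h⟩
  have pal' : ∀ x y : ℤ, P ≤ x → x < P + a ∨ x < P + d → x + y = 2 * P + (a + d) - 1 → w x = w y := by
    intro x y e1 e2 e3
    rcases lt_or_ge x (P + a) with hlt | hge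
    · rw [h2 x (y - d) e1 hlt (by omega), occPd y (y - d) (by omega) (by omega) (by omega)]
    -- A letter in the gap is moved to the right of `Q`, reflected by `hy` to the left of `P`, and
    -- moved back by the leftward return words.
    · rw [← (h _ occQ).1 (Q - a + (x - P)) x e1 (by omega) (by omega),
        hy _ (P + a - 1 - (x - P)) (by omega) (by omega) (by omega)]
      have := (h' _ ((occ _).1 occP)).1 (-1 - (P + a - 1 - (x - P))) (-Q + (x - P))
        (by omega) (by omega) (by omega)
      simp only [sub_sub_cancel] at this
      rw [this, E1 _ y (by omega) (by omega) (by omega)]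
  have pal : ∀ x y : ℤ, P ≤ x → x < P + (a + d) → x + y = 2 * P + (a + d) - 1 → w x = w y := by
    intro x y e1 e2 e3
    by_cases hx : x < P + a ∨ x < P + d
    · exact pal' x y e1 hx e3
    · exact (pal' y x (by omega) (by omega) (by omega)).symm
  refine ⟨fun x y e1 e2 e3 => ?_, pal⟩
  rw [pal x (2 * P + (a + d) - 1 - x) e1 e2 (by omega)]
  exact (E1 _ _ (by omega) (by omega) (by omega)).symm

/-- If both return lengths exceed `a + b`, then every `z` is followed by `y`, as at `Q - a`, and
every `y` by `z`, as at `P - b`. Hence `z` returns after `a + b` letters, too early. -/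
theorem PalindromicArms.extend_or_extend {α : Type*} {w : ℤ → α} {P Q : ℤ} {a b : ℕ}
    (ha : 0 < a) (hb : 0 < b)
    (hP : ReturnsExtendFirst w P) (hP' : ReturnsExtendFirst (fun x => w (-1 - x)) (-P))
    (hQ : ReturnsExtendFirst w Q) (hQ' : ReturnsExtendFirst (fun x => w (-1 - x)) (-Q))
    (hz : PalindromicArms w P Q a) (hy : PalindromicArms w Q P b) :
    ∃ d : ℤ, 0 < d ∧ (PalindromicArms w P Q (a + d) ∨ PalindromicArms w Q P (b + d)) := by
  obtain ⟨d, hd, hd1, hd2⟩ := hz.exists_extension (b := b) ha hP hQ' fun x y e1 e2 e3 =>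
    hy.1 x y e1 e2 (by omega)
  obtain ⟨e, he, he1, he2⟩ := hy.exists_extension (b := a) hb hQ hP' fun x y e1 e2 e3 =>
    hz.1 x y e1 e2 (by omega)
  rcases le_or_gt d (a + b) with hle | hgt
  · exact ⟨d, hd, Or.inl (hd1 hle)⟩
  rcases le_or_gt e (b + a) with hle' | hgt'
  · exact ⟨e, he, Or.inr (he1 hle')⟩
  exfalso
  have zP : ∀ x y : ℤ, P ≤ y → y < P + a → x - P = y - P → w x = w y := by
    intro x y _ _ e
    rw [show x = y by omega]
  have zQ : ∀ x y : ℤ, P ≤ y → y < P + a → x - (Q - a) = y - P → w x = w y := by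
    intro x y e1 e2 e3
    symm
    rw [hz.2 y (2 * P + a - 1 - y) e1 e2 (by omega),
      hz.1 _ x (by omega) (by omega) (by omega)]
  have yP : ∀ x y : ℤ, Q ≤ y → y < Q + b → x - (P - b) = y - Q → w x = w y := by
    intro x y e1 e2 e3
    symm
    rw [hy.2 y (2 * Q + b - 1 - y) e1 e2 (by omega),
      hy.1 _ x (by omega) (by omega) (by omega)]
  have yPa : ∀ x y : ℤ, Q ≤ y → y < Q + b → x - (P + a) = y - Q → w x = w y := by
    intro x y e1 e2 e3
    exact ((hd2 _ zQ).1 y x (by omega) (by omega) (by omega)).symm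
  have zPab : ∀ x y : ℤ, P ≤ y → y < P + a → x - (P + a + b) = y - P → w x = w y := by
    intro x y e1 e2 e3
    rw [(he2 _ yPa).1 x (Q + (x - P - a)) (by omega) (by omega) (by omega),
      (he2 _ yP).1 y (Q + (x - P - a)) (by omega) (by omega) (by omega)]
  have := (hd2 _ zP).2 _ zPab (by omega)
  omega

theorem forall_reflect_of_armLength {α : Type*} {w : ℤ → α} {n : ℕ} (hn : 0 < n)
    (hw : Function.Periodic w n) {P c a : ℤ} (ha : n ≤ a)
    (h : ∀ x y : ℤ, P ≤ x → x < P + a → x + y = c → w x = w y) (x : ℤ) : w x = w (c - x) := by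
  have hn' : (0 : ℤ) < n := by exact_mod_cast hn
  have h0 := Int.emod_nonneg (x - P) hn'.ne'
  have h1 := Int.emod_lt_of_pos (x - P) hn'
  have h2 := Int.emod_add_mul_ediv (x - P) n
  have e1 := hw.zsmul ((x - P) / n) (P + (x - P) % n)
  have e2 := hw.zsmul ((x - P) / n) (c - x)
  simp only [smul_eq_mul] at e1 e2
  rw [← e2, show x = P + (x - P) % n + (x - P) / n * n by linarith, e1]
  refine h _ _ (by omega) (by omega) ?_
  rw [show P + (x - P) % n + (x - P) / n * n = x by linarith]
  linarith

theorem forall_reflect_of_returnsExtendFirst {α : Type*} {w : ℤ → α} {n : ℕ} (hn : 0 < n)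
    (hw : Function.Periodic w n) {P Q : ℤ}
    (hP : ReturnsExtendFirst w P) (hP' : ReturnsExtendFirst (fun x => w (-1 - x)) (-P))
    (hQ : ReturnsExtendFirst w Q) (hQ' : ReturnsExtendFirst (fun x => w (-1 - x)) (-Q))
    (hPQ : w P = w (Q - 1)) (hQP : w Q = w (P - 1)) (x : ℤ) : w x = w (P + Q - 1 - x) := by
  have grow : ∀ k : ℕ, ∃ a b : ℕ, 0 < a ∧ 0 < b ∧ k ≤ a + b ∧
      PalindromicArms w P Q a ∧ PalindromicArms w Q P b := by
    intro k
    induction k with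
    | zero =>
      refine ⟨1, 1, one_pos, one_pos, by omega, ⟨?_, ?_⟩, ⟨?_, ?_⟩⟩ <;> intro x y e1 e2 e3 <;>
        push_cast at e2 e3
      · rw [show x = P by omega, show y = Q - 1 by omega, hPQ]
      · rw [show x = y by omega]
      · rw [show x = Q by omega, show y = P - 1 by omega, hQP]
      · rw [show x = y by omega]
    | succ k ih =>
      obtain ⟨a, b, ha, hb, hk, hz, hy⟩ := ih
      obtain ⟨d, hd, h⟩ := hz.extend_or_extend ha hb hP hP' hQ hQ' hy
      lift d to ℕ using hd.le
      rcases h with h | h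
      · exact ⟨a + d, b, by omega, hb, by omega, by exact_mod_cast h, hy⟩
      · exact ⟨a, b + d, ha, by omega, by omega, hz, by exact_mod_cast h⟩
  -- Total length `2n` forces one arm to cover a full period.
  obtain ⟨a, b, -, -, hab, hz, hy⟩ := grow (n + n)
  rcases le_or_gt n a with h | h
  · exact forall_reflect_of_armLength hn hw (by exact_mod_cast h) hz.1 x
  · rw [show P + Q - 1 - x = Q + P - 1 - x by ring]
    exact forall_reflect_of_armLength hn hw (a := b) (by omega) hy.1 x

/-! ### Binary words with two critical points -/

theorem CriticalPoint.reverse {α : Type*} {w : ℤ → α} {n : ℕ} {i : ℤ} :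
    CriticalPoint (fun x => w (-1 - x)) n i ↔ CriticalPoint w n (-i) := by
  have aux : ∀ (w : ℤ → α) (i : ℤ), CriticalPoint w n (-i) →
      CriticalPoint (fun x => w (-1 - x)) n i := by
    intro w i h p hp hpn
    obtain ⟨t, ht, hne⟩ := h p hp hpn
    refine ⟨p - 1 - t, by omega, fun he => hne ?_⟩
    dsimp only at he
    rw [show -1 - (i - p + (p - 1 - t : ℕ)) = -i + t by
        push_cast [show 1 ≤ p by omega, show t ≤ p - 1 by omega]; ring,
      show -1 - (i + (p - 1 - t : ℕ)) = -i - p + t by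
        push_cast [show 1 ≤ p by omega, show t ≤ p - 1 by omega]; ring] at he
    exact he.symm
  refine ⟨fun h => ?_, aux w i⟩
  have := aux (fun x => w (-1 - x)) (-i) (by simpa using h)
  simpa using this

theorem CriticalPoint.ne_pred {w : ℤ → Bool} {n : ℕ} {i : ℤ} (hn : 1 < n)
    (h : CriticalPoint w n i) : w (i - 1) = !w i := by
  obtain ⟨t, ht, hne⟩ := h 1 one_pos hn
  obtain rfl : t = 0 := by omega
  have hne' : w (i - 1) ≠ w i := by simpa using hne
  exact Bool.eq_not.2 hne'

theorem ReturnsExtendFirst.of_comp {α β : Type*} {w : ℤ → α} {P : ℤ} {f : α → β}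
    (hf : Function.Injective f) (h : ReturnsExtendFirst (fun x => f (w x)) P) :
    ReturnsExtendFirst w P := by
  simpa only [ReturnsExtendFirst, hf.eq_iff] using h

theorem CriticalPoint.comp_iff {α β : Type*} {w : ℤ → α} {n : ℕ} {i : ℤ} {f : α → β}
    (hf : Function.Injective f) : CriticalPoint (fun x => f (w x)) n i ↔ CriticalPoint w n i := by
  simp only [CriticalPoint, hf.ne_iff]

theorem returnsExtendFirst_of_false {w : ℤ → Bool} {n : ℕ} {P : ℤ} (hn : 0 < n)
    (hw : Function.Periodic w n) (hc : CriticalPoint w n P) (hP : w P = false)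
    (huniq : ∀ i, CriticalPoint w n i → w i = w P → ∀ x : ℤ, w (i + x) = w (P + x)) :
    ReturnsExtendFirst w P := by
  obtain ⟨i, hi⟩ := exists_lexMinAt hn hw
  have h0 : w i ≤ w P := by simpa using hi P 0 (by simp)
  have h := huniq i (hi.criticalPoint hn hw hc) (by
    rw [hP] at h0 ⊢; exact le_bot_iff.1 h0)
  refine returnsExtendFirst_of_unique hn hw hc (fun j t hs => ?_) huniq
  rw [← h]
  exact hi j t fun s hst => by rw [hs s hst, h]

theorem returnsExtendFirst_of_bool {w : ℤ → Bool} {n : ℕ} {P : ℤ} (hn : 0 < n)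
    (hw : Function.Periodic w n) (hc : CriticalPoint w n P)
    (huniq : ∀ i, CriticalPoint w n i → w i = w P → ∀ x : ℤ, w (i + x) = w (P + x)) :
    ReturnsExtendFirst w P := by
  have hnot : Function.Injective not := Bool.not_injective
  cases hP : w P with
  | false => exact returnsExtendFirst_of_false hn hw hc hP huniq
  | true =>
    refine ReturnsExtendFirst.of_comp hnot (returnsExtendFirst_of_false hn
      (fun x => congrArg not (hw x)) ((CriticalPoint.comp_iff hnot).2 hc) (by simp [hP])
      fun i hi he x => congrArg not (huniq i ((CriticalPoint.comp_iff hnot).1 hi) (hnot he) x))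

/-- A periodic binary word with two critical points, up to the period, is symmetric. -/
theorem forall_reflect_of_criticalPoints {w : ℤ → Bool} {n : ℕ} (hn : 1 < n)
    (hw : Function.Periodic w n) {P Q : ℤ} (hP : CriticalPoint w n P) (hQ : CriticalPoint w n Q)
    (hcrit : ∀ i, CriticalPoint w n i →
      (∀ x : ℤ, w (i + x) = w (P + x)) ∨ ∀ x : ℤ, w (i + x) = w (Q + x)) (x : ℤ) :
    w x = w (P + Q - 1 - x) := by
  have hn0 : 0 < n := by omega
  obtain ⟨i, hi⟩ := exists_lexMinAt (α := Bool) hn0 hw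
  obtain ⟨j, hj⟩ := exists_lexMinAt (α := Boolᵒᵈ) hn0 hw
  have hi' : CriticalPoint w n i := hi.criticalPoint hn0 hw hP
  have hj' : CriticalPoint w n j := LexMinAt.criticalPoint (α := Boolᵒᵈ) hn0 hw hP hj
  -- Here `w i` is the least letter and `w j` the greatest; if they were equal, `w (i - 1) = w i`
  -- would contradict criticality.
  have hij : w i ≠ w j := by
    intro he
    have h1 : w i ≤ w (i - 1) := by simpa using hi (i - 1) 0 (by simp)
    have h2 : w (i - 1) ≤ w j := by
      have := hj (i - 1) 0 (by simp)
      simp only [Nat.cast_zero, add_zero] at this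
      exact this
    exact absurd (hi'.ne_pred hn) (by rw [le_antisymm (h2.trans he.ge) h1]; simp)
  have hPQ : w P ≠ w Q := by
    intro he
    have : ∀ k, CriticalPoint w n k → w k = w P := by
      intro k hk
      rcases hcrit k hk with h | h
      · simpa using h 0
      · simpa [he] using h 0
    exact hij ((this i hi').trans (this j hj').symm)
  have hP1 := hP.ne_pred hn
  have hQ1 := hQ.ne_pred hn
  have hP0 : ∀ k, CriticalPoint w n k → w k = w P → ∀ x : ℤ, w (k + x) = w (P + x) := by
    intro k hk he
    refine (hcrit k hk).resolve_right fun h => hPQ ?_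
    rw [← he]; simpa using h 0
  have hQ0 : ∀ k, CriticalPoint w n k → w k = w Q → ∀ x : ℤ, w (k + x) = w (Q + x) := by
    intro k hk he
    refine (hcrit k hk).resolve_left fun h => hPQ ?_
    rw [← he]; simpa using (h 0).symm
  have hrev : ∀ R : ℤ, CriticalPoint w n R →
      (∀ k, CriticalPoint w n k → w k = w R → ∀ x : ℤ, w (k + x) = w (R + x)) →
      ReturnsExtendFirst (fun x => w (-1 - x)) (-R) := by
    intro R hR hR0
    refine returnsExtendFirst_of_bool hn0 (fun x => ?_)
      (CriticalPoint.reverse.2 (by simpa using hR)) fun k hk he x => ?_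
    · have := hw (-1 - (x + n))
      rw [← this]; congr 1; ring
    -- The letter read first leftwards is the complement of the one read first rightwards, so
    -- uniqueness by letter survives reversal.
    · have hk' := CriticalPoint.reverse.1 hk
      have h1 := hk'.ne_pred hn
      have h2 := hR.ne_pred hn
      rw [show -1 - k = -k - 1 by ring, h1, show -1 - -R = R - 1 by ring, h2] at he
      have := hR0 _ hk' (Bool.not_injective he) (-1 - x)
      convert this using 2 <;> ring
  refine forall_reflect_of_returnsExtendFirst hn0 hw (returnsExtendFirst_of_bool hn0 hw hP hP0)
    (hrev P hP hP0) (returnsExtendFirst_of_bool hn0 hw hQ hQ0) (hrev Q hQ hQ0) ?_ ?_ x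
  · rw [hQ1]; revert hPQ; cases w P <;> cases w Q <;> simp
  · rw [hP1]; revert hPQ; cases w P <;> cases w Q <;> simp

/-! ### From finite words to periodic words -/

/-- The periodic bi-infinite word with period `w`. -/
def cyclicExtension (w : List Bool) (x : ℤ) : Bool := w.getD (x % w.length).toNat false

theorem cyclicExtension_periodic (w : List Bool) :
    Function.Periodic (cyclicExtension w) w.length := fun x => by
  simp [cyclicExtension]

theorem cyclicExtension_natCast {w : List Bool} {t : ℕ} (ht : t < w.length) :
    cyclicExtension w t = w[t] := by
  have : ((t : ℤ) % w.length).toNat = t := by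
    rw [Int.emod_eq_of_lt (by omega) (by omega)]; simp
  simp [cyclicExtension, this, ht]

theorem cyclicExtension_emod (w : List Bool) (x : ℤ) :
    cyclicExtension w (x % w.length) = cyclicExtension w x := by
  simp [cyclicExtension]

theorem cyclicExtension_rotate (w : List Bool) (k : ℕ) (x : ℤ) :
    cyclicExtension (w.rotate k) x = cyclicExtension w (x + k) := by
  rcases Nat.eq_zero_or_pos w.length with h0 | h0
  · simp [cyclicExtension, List.length_eq_zero_iff.1 h0]
  have h0' : (0 : ℤ) < w.length := by exact_mod_cast h0
  rw [← cyclicExtension_emod, ← cyclicExtension_emod w, ← Int.emod_add_emod,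
    ← cyclicExtension_emod w, List.length_rotate]
  obtain ⟨t, ht⟩ := Int.eq_ofNat_of_zero_le (Int.emod_nonneg x h0'.ne')
  have hlt := Int.emod_lt_of_pos x h0'
  rw [ht] at hlt ⊢
  rw [cyclicExtension_natCast (by simpa using hlt), List.getElem_rotate, cyclicExtension_emod,
    ← cyclicExtension_natCast (Nat.mod_lt _ h0)]
  push_cast
  rfl

theorem unbordered_iff_take_ne_drop {α : Type*} {w : List α} :
    Unbordered w ↔ ∀ p, 0 < p → p < w.length → w.take p ≠ w.drop (w.length - p) := by
  constructor
  · intro h p hp hpn he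
    refine h ⟨w.take p, ?_, ?_, List.take_prefix _ _, he ▸ List.drop_suffix _ _⟩
    · intro h'
      have := congrArg List.length h'
      simp only [List.length_take, List.length_nil] at this
      omega
    · intro h'
      have := congrArg List.length h'
      simp only [List.length_take] at this
      omega
  · rintro h ⟨b, hb0, hbw, hpre, hsuf⟩
    have hle := hpre.length_le
    refine h b.length (List.length_pos_iff.2 hb0) (hle.lt_of_ne fun h' => hbw
      (hpre.eq_of_length h')) ?_
    rw [← List.prefix_iff_eq_take.1 hpre, ← List.suffix_iff_eq_drop.1 hsuf]

theorem unbordered_iff_criticalPoint {w : List Bool} :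
    Unbordered w ↔ CriticalPoint (cyclicExtension w) w.length 0 := by
  rw [unbordered_iff_take_ne_drop]
  refine forall_congr' fun p => forall_congr' fun hp => forall_congr' fun hpn => ?_
  have h1 : ∀ t (ht : t < p), cyclicExtension w (0 - p + t) =
      (w.drop (w.length - p))[t]'(by simp; omega) := by
    intro t ht
    rw [List.getElem_drop, ← cyclicExtension_natCast, ← cyclicExtension_periodic w]
    congr 1; push_cast [hpn.le]; ring
  have h2 : ∀ t (ht : t < p), cyclicExtension w (0 + t) = (w.take p)[t]'(by simp; omega) := by
    intro t ht
    rw [List.getElem_take, zero_add, cyclicExtension_natCast]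
  rw [← not_iff_not]
  push Not
  constructor
  · intro he t ht
    rw [h1 t ht, h2 t ht]
    simp [he]
  · intro he
    refine List.ext_getElem (by simp; omega) fun t ht ht' => ?_
    have : t < p := by simp at ht; omega
    rw [← h1 t this, ← h2 t this, he t this]

theorem unbordered_rotate_iff_criticalPoint {w : List Bool} {k : ℕ} :
    Unbordered (w.rotate k) ↔ CriticalPoint (cyclicExtension w) w.length k := by
  rw [unbordered_iff_criticalPoint, List.length_rotate]
  simp only [CriticalPoint, cyclicExtension_rotate]
  refine forall_congr' fun p => forall_congr' fun _ => forall_congr' fun _ =>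
    exists_congr fun t => and_congr_right fun _ => ?_
  rw [show (0 : ℤ) - p + t + k = k - p + t by ring, show (0 : ℤ) + t + k = k + t by ring]

/-- The reflection reverses `[0, l)` and, modulo the period, also `[l, w.length)`. -/
theorem palindrome_take_and_drop {w : List Bool} {l : ℕ} (hl : l ≤ w.length)
    (h : ∀ x, cyclicExtension w x = cyclicExtension w (l - 1 - x)) :
    (w.take l).Palindrome ∧ (w.drop l).Palindrome := by
  constructor <;> refine List.Palindrome.of_reverse_eq (List.ext_getElem (by simp) ?_)
  · intro t h1 h2
    have ht : t < l := by simp at h2; omega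
    simp only [List.getElem_reverse, List.getElem_take, List.length_take, min_eq_left hl]
    rw [← cyclicExtension_natCast, ← cyclicExtension_natCast, h]
    congr 1
    push_cast [show 1 ≤ l by omega, show t ≤ l - 1 by omega]; ring
  · intro t h1 h2
    have ht : l + t < w.length := by simp at h2; omega
    simp only [List.getElem_reverse, List.getElem_drop, List.length_drop]
    rw [← cyclicExtension_natCast, ← cyclicExtension_natCast, h, ← cyclicExtension_periodic w]
    congr 1
    push_cast [hl, show 1 ≤ w.length - l by omega, show t ≤ w.length - l - 1 by omega]; ring

theorem cyclicExtension_reflect_of_pair {u v w : List Bool} (hw : FullyBordered w)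
    (h : unborderedConjugates w = {u ++ v, v ++ u}) (x : ℤ) :
    cyclicExtension (u ++ v) x = cyclicExtension (u ++ v) (u.length - 1 - x) := by
  have hrot : w ~r (u ++ v) := (h.ge (by simp) : u ++ v ∈ unborderedConjugates w).1
  have hn : 1 < (u ++ v).length := hrot.perm.length_eq ▸ hw.1
  have huv : Unbordered (u ++ v) := (h.ge (by simp) : u ++ v ∈ unborderedConjugates w).2
  have hvu : Unbordered (v ++ u) := (h.ge (by simp) : v ++ u ∈ unborderedConjugates w).2
  have hrl := List.rotate_append_length_eq u v
  have := forall_reflect_of_criticalPoints hn (cyclicExtension_periodic (u ++ v))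
    (unbordered_iff_criticalPoint.1 huv)
    (unbordered_rotate_iff_criticalPoint.1 (hrl.symm ▸ hvu)) (fun i hi => ?_) x
  · simpa using this
  have hn' : (0 : ℤ) < (u ++ v).length := by omega
  obtain ⟨k, hk⟩ := Int.eq_ofNat_of_zero_le (Int.emod_nonneg i hn'.ne')
  have hshift : ∀ x : ℤ, cyclicExtension (u ++ v) (i + x) =
      cyclicExtension ((u ++ v).rotate k) x := by
    intro x
    rw [cyclicExtension_rotate, ← cyclicExtension_emod, ← Int.emod_add_emod, hk,
      cyclicExtension_emod, add_comm]
  have hunb : Unbordered ((u ++ v).rotate k) := by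
    rw [unbordered_iff_criticalPoint, List.length_rotate]
    intro p hp hpn
    obtain ⟨t, ht, hne⟩ := hi p hp hpn
    refine ⟨t, ht, ?_⟩
    rwa [← hshift, ← hshift, show i + (0 - p + t) = i - p + t by ring, zero_add]
  have hmem : (u ++ v).rotate k ∈ unborderedConjugates w := ⟨hrot.trans ⟨k, rfl⟩, hunb⟩
  rw [h] at hmem
  rcases hmem with he | he
  · left
    intro x
    rw [hshift, he, zero_add]
  · right
    intro x
    rw [hshift, Set.mem_singleton_iff.1 he, ← hrl, cyclicExtension_rotate, add_comm]

theorem FullyBordered.exists_palindrome_append {w : List Bool} (hw : FullyBordered w) :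
    ∃ p q : List Bool, p.Palindrome ∧ q.Palindrome ∧ w = p ++ q := by
  obtain ⟨a, b, -, hab⟩ := Set.ncard_eq_two.1 hw.2
  have ha : w ~r a := (hab.ge (by simp) : a ∈ unborderedConjugates w).1
  have hb : w ~r b := (hab.ge (by simp) : b ∈ unborderedConjugates w).1
  obtain ⟨k, hk, rfl⟩ := List.isRotated_iff_mod.1 (ha.symm.trans hb)
  have h : unborderedConjugates w = {a.take k ++ a.drop k, a.drop k ++ a.take k} := by
    rw [hab, List.take_append_drop, List.rotate_eq_drop_append_take hk]
  have hrefl := cyclicExtension_reflect_of_pair hw h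
  rw [List.take_append_drop] at hrefl
  obtain ⟨j, rfl⟩ := ha.symm
  -- Rotating by `j` moves the reflection sum by `2 * j`; the split point `l` is the residue of `c`
  -- modulo the length.
  set c : ℤ := (a.take k).length - 2 * j with hc
  have hn : (0 : ℤ) < (a.rotate j).length := by exact_mod_cast zero_lt_one.trans hw.1
  obtain ⟨l, hl⟩ := Int.eq_ofNat_of_zero_le (Int.emod_nonneg c hn.ne')
  have hlt := Int.emod_lt_of_pos c hn
  have hl' : l ≤ (a.rotate j).length := by omega
  have hdiv := Int.emod_add_mul_ediv c (a.rotate j).length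
  have key := palindrome_take_and_drop hl' fun x => by
    have hper := (cyclicExtension_periodic (a.rotate j)).zsmul (c / (a.rotate j).length)
      (l - 1 - x)
    rw [← hper, cyclicExtension_rotate, cyclicExtension_rotate, hrefl]
    congr 1
    rw [hl] at hdiv
    simp only [smul_eq_mul]
    have : (l : ℤ) = Int.ofNat l := rfl
    linarith
  exact ⟨_, _, key.1, key.2, (List.take_append_drop _ _).symm⟩

/-! ### Palindromic length -/

theorem palindromicLength_le_of_append {α : Type*} {p q : List α} (hp : p.Palindrome)
    (hq : q.Palindrome) : palindromicLength (p ++ q) ≤ 2 := by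
  classical
  have hle : (([p, q].filter fun l => l ≠ []).length) ≤ 2 := List.length_filter_le _ _
  refine le_trans (Nat.sInf_le ⟨[p, q].filter fun l => l ≠ [], rfl, ?_, ?_⟩) hle
  · intro r hr
    simp only [List.mem_filter, List.mem_cons, List.not_mem_nil, or_false,
      decide_eq_true_eq] at hr
    rcases hr with ⟨rfl | rfl, h⟩
    exacts [⟨h, hp⟩, ⟨h, hq⟩]
  · by_cases h1 : p = [] <;> by_cases h2 : q = [] <;> simp [h1, h2]

theorem two_le_palindromicLength {α : Type*} {w : List α} (hw : ¬ w.Palindrome) :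
    2 ≤ palindromicLength w := by
  obtain ⟨l, hl, hpal, hflat⟩ := exists_palindromic_factorization w
  by_contra! hlt
  rw [← hl] at hlt
  match l, hlt with
  | [], _ => exact hw (by rw [← hflat]; exact List.Palindrome.nil)
  | [p], _ => exact hw (by rw [← hflat]; simpa using (hpal p (by simp)).2)

theorem Unbordered.not_palindrome {α : Type*} {w : List α} (hw : Unbordered w)
    (hn : 1 < w.length) : ¬ w.Palindrome := by
  intro h
  refine unbordered_iff_take_ne_drop.1 hw 1 one_pos hn ?_
  have hr := h.reverse_eq
  have h1 : (w.take 1).reverse = w.drop (w.length - 1) := by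
    rw [List.reverse_take, hr]
  rw [← h1]
  obtain ⟨a, t, rfl⟩ := List.exists_cons_of_length_pos (zero_lt_one.trans hn)
  simp

theorem mainTheorem3 :
    (∀ u v : List Bool, FullyBorderedPair u v → u.Palindrome ∧ v.Palindrome) ∧
    (∀ w : List Bool, FullyBordered w →
      (∃ p q : List Bool, p.Palindrome ∧ q.Palindrome ∧ w = p ++ q) ∧
      palindromicLength w ≤ 2 ∧
      (¬ w.Palindrome → palindromicLength w = 2) ∧
      (Unbordered w → palindromicLength w = 2)) := by
  constructor
  · rintro u v ⟨w, hw, h⟩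
    simpa using palindrome_take_and_drop (w := u ++ v) (l := u.length) (by simp)
      (cyclicExtension_reflect_of_pair hw h)
  · intro w hw
    obtain ⟨p, q, hp, hq, rfl⟩ := hw.exists_palindrome_append
    have hle := palindromicLength_le_of_append hp hq
    have hnot : ¬ (p ++ q).Palindrome → palindromicLength (p ++ q) = 2 := fun h =>
      le_antisymm hle (two_le_palindromicLength h)
    exact ⟨⟨p, q, hp, hq, rfl⟩, hle, hnot, fun hu => hnot (hu.not_palindrome hw.1)⟩
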